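/- An mm-space is a triple $X=(X,d_X,\mu_X)$, where $(X,d_X)$ is a complete separable metric space and $\mu_X$ is a Borel probability measure on $X$. An mm-space $X$ dominates an mm-space $Y$, written $Y\prec X$, if there is a $1$-Lipschitz map $f:X\to Y$ with $f_*\mu_X=\mu_Y$. A parameter of $X$ is a Borel map $\varphi:[0,1)\to X$ with $\varphi_*\mathcal L^1=\mu_X$, where $\mathcal L^1$ is Lebesgue measure on $[0,1)$. The box distance $\Box(X,Y)$ is the infimum, over all parameters $\varphi$ of $X$ and $\psi$ of $Y$, of the infimum of those $\varepsilon\ge 0$ for which there is a Borel set $I_0\subset[0,1)$ with $\mathcal L^1(I_0)\ge 1-\varepsilon$ and $$|d_X(\varphi(s),\varphi(t))-d_Y(\psi(s),\psi(t))|\le\varepsilon\quad\text{for all } s,t\in I_0.$$ A set $\mathcal Y$ of mm-spaces is $\Box$-precompact if for every $\varepsilon>0$ there is a finite set $F$ of mm-spaces such that every $Y\in\mathcal Y$ satisfies $\Box(Y,Z)<\varepsilon$ for some $Z\in F$. (Since $\Box$ is a complete metric on the set of isomorphism classes of mm-spaces, this is equivalent to relative compactness.) **Theorem.** If a set $\mathcal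 Y$ of mm-spaces is $\Box$-precompact, then there exists an mm-space $X$ such that $Y\prec X$ for every $Y\in\mathcal Y$. -/

import Mathlib

open MeasureTheory
open scoped ENNReal

universe u

noncomputable section

/-- A metric measure space: a complete separable metric space with a Borel probability measure. -/
structure MMSpace : Type (u + 1) where
  carrier : Type u
  [metric : MetricSpace carrier]
  [complete : CompleteSpace carrier]
  [separable : TopologicalSpace.SeparableSpace carrier]
  [measurable : MeasurableSpace carrier]
  [borel : BorelSpace carrier]
  measure : Measure carrier
  [prob : IsProbabilityMeasure measure]

namespace MMSpace

instance : CoeSort MMSpace.{u} (Type u) := ⟨carrier⟩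

attribute [instance] metric complete separable measurable borel prob

/-- `Y.DominatedBy X` is the Lipschitz order `Y ≺ X`. -/
def DominatedBy (Y X : MMSpace.{u}) : Prop :=
  ∃ f : X → Y, LipschitzWith 1 f ∧ Measure.map f X.measure = Y.measure

/-- The interval `[0, 1)`, with the Borel σ-algebra it has as a subtype of `ℝ`. -/
abbrev ParamInterval : Type := Set.Ico (0 : ℝ) 1

/-- Lebesgue measure on `[0, 1)`. -/
def lebesgue : Measure ParamInterval := Measure.comap Subtype.val (volume : Measure ℝ)

/-- A parameter of `X`: a Borel map from `[0, 1)` pushing Lebesgue measure to the measure of `X`. -/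
structure Parameter (X : MMSpace.{u}) where
  toFun : ParamInterval → X
  measurable_toFun : Measurable toFun
  map_lebesgue : Measure.map toFun lebesgue = X.measure

/-- The box distance between two (pseudo-metric) functions on `[0, 1)`: the infimum of all `ε ≥ 0`
such that they differ by at most `ε` on a Borel set of Lebesgue measure at least `1 - ε`
(`ε = 1` always qualifies, with the empty set). -/
def boxInterval (ρ₁ ρ₂ : ParamInterval → ParamInterval → ℝ) : ℝ :=
  sInf {ε : ℝ | 0 ≤ ε ∧ ∃ I₀ : Set ParamInterval, MeasurableSet I₀ ∧
    (∀ s ∈ I₀, ∀ t ∈ I₀, |ρ₁ s t - ρ₂ s t| ≤ ε) ∧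
    1 - ε ≤ lebesgue.real I₀}

/-- The box distance: the infimum of the box distances of the pulled back metrics, over all
parameters of `X` and of `Y`. -/
def box (X Y : MMSpace.{u}) : ℝ≥0∞ :=
  ⨅ (φ : Parameter X) (ψ : Parameter Y),
    ENNReal.ofReal (boxInterval (fun s t => dist (φ.toFun s) (φ.toFun t))
      (fun s t => dist (ψ.toFun s) (ψ.toFun t)))

/-- Precompactness for the box distance: for every `ε > 0`, the family is covered by finitely many
box-balls of radius `ε`. The box distance being complete, this is the same as having compact
closure. -/
def BoxPrecompact (𝒴 : Set MMSpace.{u}) : Prop :=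
  ∀ ε : ℝ≥0∞, 0 < ε → ∃ F : Set MMSpace.{u}, F.Finite ∧ ∀ Y ∈ 𝒴, ∃ Z ∈ F, box Y Z < ε

end MMSpace

end

/-! The difficulty is that X must serve all Y at once, so it may depend only on data uniform over
the family. Precompactness supplies such data: for each `n`, numbers `N n` and `D n` such that every
Y has `N n` closed sets of diameter at most `(1/2)^(n+1)`, jointly of diameter at most `D n`, that
miss mass at most `(1/2)^(n+1)` (`BoxPrecompact.exists_isCover`).

If N sets cover what is left of a measure, one of them carries at least 1/N of it. Cutting off
exactly 1/N and repeating splits the measure into localized pieces whose masses follow a geometric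
law, which depends on N but not on the measure (`exists_geometric_decomposition`). Iterating over
the scales gives, for each Y, a tree of pieces indexed by finite sequences, with the same masses for
all Y: those of cylinders under a product of geometric laws on `ℕ → ℕ`. Sending a branch to the
common point of its nodes pushes this product to the measure of Y (`MassTree.map_treeMeasure`).

The uncovered mass is absorbed at level 0: the `j`-th piece there lies in a core that is covered at
every scale from `j + 1` on. On that piece the nodes shrink only from a level depending on `j`, and
the earlier levels are paid for by scaling the ultrametric with a factor `c j`
(`MassTree.dist_le_treeDist`). -/

noncomputable section

open Filter Topology

namespace MMSpace

/-! ### Splitting a measure into pieces of geometric masses -/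

section

/-- The mass that the geometric law with success probability `1 / N` gives to `j`. -/
def geomWeight (N j : ℕ) : ℝ≥0∞ := (1 - (N : ℝ≥0∞)⁻¹) ^ j * (N : ℝ≥0∞)⁻¹

lemma tsum_geomWeight {N : ℕ} (hN : 2 ≤ N) : ∑' j, geomWeight N j = 1 := by
  have h1 : (N : ℝ≥0∞)⁻¹ ≤ 1 := by
    rw [ENNReal.inv_le_one]; exact_mod_cast (by omega : 1 ≤ N)
  simp only [geomWeight]
  rw [ENNReal.tsum_mul_right, ENNReal.tsum_geometric, ENNReal.sub_sub_cancel ENNReal.one_ne_top h1,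
    inv_inv]
  exact ENNReal.mul_inv_cancel (by exact_mod_cast (by omega : N ≠ 0)) (ENNReal.natCast_ne_top N)

lemma one_sub_inv_natCast_lt_one (N : ℕ) : 1 - (N : ℝ≥0∞)⁻¹ < 1 :=
  ENNReal.sub_lt_self ENNReal.one_ne_top one_ne_zero (by simp)

lemma geomWeight_ne_zero {N : ℕ} (hN : 2 ≤ N) (j : ℕ) : geomWeight N j ≠ 0 := by
  have h : (N : ℝ≥0∞)⁻¹ < 1 := by
    rw [ENNReal.inv_lt_one]; exact_mod_cast (by omega : 1 < N)
  exact mul_ne_zero (pow_ne_zero _ (tsub_pos_of_lt h).ne') (by simp)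

/-- The geometric law on `ℕ` with success probability `1 / N`. -/
def geomMeasure (N : ℕ) : Measure ℕ := Measure.sum fun j => geomWeight N j • Measure.dirac j

lemma geomMeasure_singleton (N j : ℕ) : geomMeasure N {j} = geomWeight N j := by
  rw [geomMeasure, Measure.sum_apply _ (measurableSet_singleton j), tsum_eq_single j]
  · simp
  · intro i hi
    simp [hi]

lemma isProbabilityMeasure_geomMeasure {N : ℕ} (hN : 2 ≤ N) :
    IsProbabilityMeasure (geomMeasure N) := by
  constructor
  rw [geomMeasure, Measure.sum_apply _ MeasurableSet.univ]
  simpa using tsum_geomWeight hN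

variable {Y : Type*} [MeasurableSpace Y]

/-- A part of prescribed mass can be split off a measure inside a set that carries enough mass. -/
lemma exists_add_eq_of_le (ν : Measure Y) [IsFiniteMeasure ν] {K : Set Y} (hK : MeasurableSet K)
    {a : ℝ≥0∞} (ha : a ≤ ν K) :
    ∃ α β : Measure Y, α + β = ν ∧ α Set.univ = a ∧ α Kᶜ = 0 := by
  rcases eq_or_ne (ν K) 0 with h0 | h0
  · exact ⟨0, ν, by simp, by simpa [h0, eq_comm] using ha, by simp⟩
  have hc : a / ν K ≤ 1 := ENNReal.div_le_of_le_mul (by simpa using ha)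
  refine ⟨(a / ν K) • ν.restrict K, (1 - a / ν K) • ν.restrict K + ν.restrict Kᶜ, ?_, ?_, ?_⟩
  · rw [← add_assoc, ← add_smul, add_tsub_cancel_of_le hc, one_smul,
      Measure.restrict_add_restrict_compl hK]
  · simp [ENNReal.div_mul_cancel h0 (measure_ne_top ν K)]
  · simp [Measure.restrict_apply hK.compl]

/-- Greedy decomposition: if at every stage some allowed set carries at least `1 / N` of what is
left, then `ν` is the sum of pieces of geometric masses, the `j`-th one living on a set allowed at
stage `j`. -/
lemma exists_geometric_decomposition (ν : Measure Y) [IsFiniteMeasure ν] {N : ℕ} (hN : 2 ≤ N)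
    (T : ℕ → ℕ → Set Y) (hT : ∀ j k, MeasurableSet (T j k))
    (h : ∀ (j : ℕ) (lam : Measure Y), lam ≤ ν →
      lam Set.univ = (1 - (N : ℝ≥0∞)⁻¹) ^ j * ν Set.univ →
      ∃ k, lam Set.univ * (N : ℝ≥0∞)⁻¹ ≤ lam (T j k)) :
    ∃ (p : ℕ → Measure Y) (k : ℕ → ℕ), (∀ j, p j Set.univ = geomWeight N j * ν Set.univ) ∧
      (∀ A, ∑' j, p j A = ν A) ∧ ∀ j, p j (T j (k j))ᶜ = 0 := by
  set r : ℝ≥0∞ := 1 - (N : ℝ≥0∞)⁻¹ with hr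
  have hN1 : (N : ℝ≥0∞)⁻¹ ≤ 1 := by
    rw [ENNReal.inv_le_one]; exact_mod_cast (by omega : 1 ≤ N)
  have step : ∀ (j : ℕ) (lam : Measure Y), ∃ (α β : Measure Y) (k : ℕ),
      lam ≤ ν → lam Set.univ = r ^ j * ν Set.univ →
        α + β = lam ∧ α Set.univ = lam Set.univ * (N : ℝ≥0∞)⁻¹ ∧ α (T j k)ᶜ = 0 := by
    intro j lam
    -- Junk values off the hypotheses make the choice total, so that the recursion for `rest` needs
    -- no proofs.
    by_cases hl : lam ≤ ν ∧ lam Set.univ = r ^ j * ν Set.univ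
    · obtain ⟨k, hk⟩ := h j lam hl.1 hl.2
      have : IsFiniteMeasure lam := isFiniteMeasure_of_le ν hl.1
      obtain ⟨α, β, h1, h2, h3⟩ := exists_add_eq_of_le lam (hT j k) hk
      exact ⟨α, β, k, fun _ _ => ⟨h1, h2, h3⟩⟩
    · exact ⟨0, 0, 0, fun h1 h2 => absurd ⟨h1, h2⟩ hl⟩
  choose α β k hs using step
  let rest : ℕ → Measure Y := fun j => Nat.rec ν (fun j lam => β j lam) j
  have hrest : ∀ j, rest j ≤ ν ∧ rest j Set.univ = r ^ j * ν Set.univ := by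
    intro j
    induction j with
    | zero => simp [rest]
    | succ j ih =>
      obtain ⟨h1, h2, -⟩ := hs j (rest j) ih.1 ih.2
      have hβ : β j (rest j) ≤ rest j := by
        conv_rhs => rw [← h1]
        exact Measure.le_add_left le_rfl
      refine ⟨hβ.trans ih.1, ?_⟩
      have hfin : rest j Set.univ ≠ ∞ :=
        ((ih.1 Set.univ).trans_lt (measure_lt_top ν _)).ne
      have hsum : rest j Set.univ * (N : ℝ≥0∞)⁻¹ + β j (rest j) Set.univ = rest j Set.univ := by
        rw [← h2]; conv_rhs => rw [← h1]
        rfl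
      have hsum' : rest j Set.univ * (N : ℝ≥0∞)⁻¹ + rest j Set.univ * r = rest j Set.univ := by
        rw [← mul_add, hr, add_tsub_cancel_of_le hN1, mul_one]
      have : β j (rest j) Set.univ = rest j Set.univ * r :=
        (ENNReal.add_right_inj (ENNReal.mul_ne_top hfin (ne_top_of_le_ne_top
          ENNReal.one_ne_top hN1))).1 (hsum.trans hsum'.symm)
      change β j (rest j) Set.univ = _
      rw [this, ih.2, pow_succ]
      ring
  refine ⟨fun j => α j (rest j), fun j => k j (rest j), fun j => ?_, fun A => ?_, fun j => ?_⟩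
  · rw [(hs j _ (hrest j).1 (hrest j).2).2.1, (hrest j).2, geomWeight]
    ring
  · have hpart : ∀ J, ∑ j ∈ Finset.range J, α j (rest j) A + rest J A = ν A := by
      intro J
      induction J with
      | zero => simp [rest]
      | succ J ih =>
        rw [← ih, Finset.sum_range_succ, add_assoc]
        congr 1
        conv_rhs => rw [← (hs J _ (hrest J).1 (hrest J).2).1]
        rfl
    -- The remainders have mass `r ^ J * ν univ` with `r < 1`, so the pieces exhaust `ν`.
    have hlim : Tendsto (fun J => rest J A) atTop (𝓝 0) := by
      have h0 : Tendsto (fun J => r ^ J * ν Set.univ) atTop (𝓝 0) := by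
        simpa using ENNReal.Tendsto.mul_const
          (ENNReal.tendsto_pow_atTop_nhds_zero_of_lt_one (one_sub_inv_natCast_lt_one N))
          (Or.inr (measure_ne_top ν Set.univ))
      refine tendsto_of_tendsto_of_tendsto_of_le_of_le tendsto_const_nhds h0 (fun _ => bot_le) ?_
      intro J
      exact (measure_mono (Set.subset_univ A)).trans (hrest J).2.le
    have := (ENNReal.tendsto_nat_tsum (fun j => α j (rest j) A)).add hlim
    simp only [hpart, add_zero] at this
    exact tendsto_nhds_unique this tendsto_const_nhds
  · exact (hs j _ (hrest j).1 (hrest j).2).2.2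

/-- Pigeonhole for measures. -/
lemma exists_le_measure_of_measure_compl_eq_zero {lam : Measure Y}
    {B : ℕ → Set Y} {a b : ℕ} (hab : a ≤ b) (h : lam (⋃ k ∈ Finset.range a, B k)ᶜ = 0) :
    ∃ k, lam Set.univ * (b : ℝ≥0∞)⁻¹ ≤ lam (B k) := by
  by_contra! hlt
  have hle : lam Set.univ ≤ ∑ k ∈ Finset.range a, lam (B k) := by
    rw [← Set.union_compl_self (⋃ k ∈ Finset.range a, B k)]
    refine (measure_union_le _ _).trans ?_
    rw [h, add_zero]
    exact measure_biUnion_finset_le _ _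
  have hne : (Finset.range a).Nonempty := by
    rw [Finset.nonempty_iff_ne_empty]
    intro he
    rw [he, Finset.sum_empty] at hle
    exact absurd (hlt 0) (by simp [le_antisymm hle bot_le])
  have hb : (b : ℝ≥0∞) ≠ 0 := by
    have := Finset.nonempty_range_iff.1 hne
    exact_mod_cast (by omega : b ≠ 0)
  have := hle.trans_lt (ENNReal.sum_lt_sum_of_nonempty hne fun k _ => hlt k)
  rw [Finset.sum_const, Finset.card_range, nsmul_eq_mul] at this
  refine absurd this (not_lt.2 ?_)
  calc (a : ℝ≥0∞) * (lam Set.univ * (b : ℝ≥0∞)⁻¹)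
      ≤ b * (lam Set.univ * (b : ℝ≥0∞)⁻¹) := by gcongr
    _ = lam Set.univ := by
        rw [mul_left_comm, ENNReal.mul_inv_cancel hb (ENNReal.natCast_ne_top b), mul_one]

end

/-! ### Uniform covers from box-precompactness -/

/-- `K` consists of closed sets of diameter at most `ε`, the first `N` of which cover all but a set
of measure `ε`, and all of which lie in one set of diameter at most `D`. -/
structure IsCover {Y : Type*} [MetricSpace Y] [MeasurableSpace Y] (μ : Measure Y) (ε : ℝ) (N : ℕ)
    (D : ℝ) (K : ℕ → Set Y) : Prop where
  isClosed : ∀ k, IsClosed (K k)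
  dist_le : ∀ k, ∀ y ∈ K k, ∀ z ∈ K k, dist y z ≤ ε
  dist_le' : ∀ k l, ∀ y ∈ K k, ∀ z ∈ K l, dist y z ≤ D
  measure_compl : μ (⋃ k ∈ Finset.range N, K k)ᶜ ≤ ENNReal.ofReal ε

lemma IsCover.mono {Y : Type*} [MetricSpace Y] [MeasurableSpace Y] {μ : Measure Y} {ε : ℝ}
    {N N' : ℕ} {D D' : ℝ} {K : ℕ → Set Y} (h : IsCover μ ε N D K) (hN : N ≤ N') (hD : D ≤ D') :
    IsCover μ ε N' D' K where
  isClosed := h.isClosed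
  dist_le := h.dist_le
  dist_le' k l y hy z hz := (h.dist_le' k l y hy z hz).trans hD
  measure_compl := by
    refine (measure_mono ?_).trans h.measure_compl
    exact Set.compl_subset_compl.2 (Set.biUnion_subset_biUnion_left
      (by exact_mod_cast Finset.range_subset_range.2 hN))

lemma exists_isCover (Z : MMSpace.{u}) {ε : ℝ} (hε : 0 < ε) :
    ∃ (N : ℕ) (D : ℝ) (K : ℕ → Set Z), IsCover Z.measure ε N D K := by
  have : Nonempty Z := nonempty_of_isProbabilityMeasure Z.measure
  let z := TopologicalSpace.denseSeq Z
  let B : ℕ → Set Z := fun k => Metric.closedBall (z k) (ε / 2)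
  let U : ℕ → Set Z := fun N => ⋃ k ∈ Finset.range N, B k
  have hU : ⋃ N, U N = Set.univ := by
    refine Set.eq_univ_of_forall fun y => ?_
    obtain ⟨k, hk⟩ := (TopologicalSpace.denseRange_denseSeq Z).exists_dist_lt y (half_pos hε)
    exact Set.mem_iUnion.2 ⟨k + 1, Set.mem_biUnion (Finset.mem_coe.2 (Finset.self_mem_range_succ k))
      (Metric.mem_closedBall.2 hk.le)⟩
  have hUm : ∀ N, MeasurableSet (U N) := fun N =>
    Finset.measurableSet_biUnion _ fun k _ => Metric.isClosed_closedBall.measurableSet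
  have hanti : Antitone fun N => (U N)ᶜ := fun N N' h => Set.compl_subset_compl.2
    (Set.biUnion_subset_biUnion_left (by exact_mod_cast Finset.range_subset_range.2 h))
  have hlim : Tendsto (fun N => Z.measure (U N)ᶜ) atTop (𝓝 0) := by
    have := tendsto_measure_iInter_atTop (μ := Z.measure)
      (fun N => (hUm N).compl.nullMeasurableSet) hanti ⟨0, measure_ne_top _ _⟩
    rwa [← Set.compl_iUnion, hU, Set.compl_univ, measure_empty] at this
  obtain ⟨N, hN⟩ := (hlim.eventually (gt_mem_nhds (ENNReal.ofReal_pos.2 hε))).exists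
  have hbdd : Bornology.IsBounded (U N) :=
    (Bornology.isBounded_biUnion_finset _).2 fun k _ => Metric.isBounded_closedBall
  obtain ⟨D, hD⟩ := Metric.isBounded_iff.1 hbdd
  have hsub : ∀ k, (if k < N then B k else ∅) ⊆ U N := by
    intro k
    split_ifs with h
    · exact Set.subset_biUnion_of_mem (u := B) (Finset.mem_coe.2 (Finset.mem_range.2 h))
    · exact Set.empty_subset _
  -- Balls beyond the first `N` are replaced by `∅`, since `dist_le'` concerns all indices.
  refine ⟨N, D, fun k => if k < N then B k else ∅, ?_, ?_, ?_, ?_⟩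
  · intro k
    split_ifs
    exacts [Metric.isClosed_closedBall, isClosed_empty]
  · intro k y hy w hw
    split_ifs at hy hw
    · have h1 := Metric.mem_closedBall.1 hy
      have h2 := Metric.mem_closedBall.1 hw
      linarith [dist_triangle_right y w (z k)]
    · exact hy.elim
  · intro k l y hy w hw
    exact hD (hsub k hy) (hsub l hw)
  · refine (measure_mono (Set.compl_subset_compl.2 ?_)).trans hN.le
    refine Set.iUnion₂_mono fun k hk => ?_
    rw [if_pos (Finset.mem_range.1 hk)]

instance isProbabilityMeasure_lebesgue : IsProbabilityMeasure lebesgue := by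
  constructor
  rw [lebesgue, Measure.comap_apply _ Subtype.val_injective
    (fun s hs => measurableSet_Ico.subtype_image hs) _ MeasurableSet.univ, Set.image_univ, Subtype.range_coe, Real.volume_Ico]
  simp

/-- Box-close spaces have comparable covers. -/
lemma IsCover.of_box_lt {Y Z : MMSpace.{u}} {ε : ℝ} {N : ℕ} {D : ℝ} {K : ℕ → Set Z}
    (hK : IsCover Z.measure ε N D K) (h : box Y Z < ENNReal.ofReal ε) :
    ∃ L : ℕ → Set Y, IsCover Y.measure (2 * ε) N (D + ε) L := by
  simp only [box, iInf_lt_iff] at h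
  obtain ⟨φ, ψ, h⟩ := h
  have hε : 0 < ε := ENNReal.ofReal_pos.1 (bot_le.trans_lt h)
  rw [ENNReal.ofReal_lt_ofReal_iff hε, boxInterval] at h
  obtain ⟨δ, ⟨hδ, I, hI, hdist, hmeas⟩, hδε⟩ := exists_lt_of_csInf_lt
    (by exact ⟨1, zero_le_one, ∅, MeasurableSet.empty, by simp, by simp⟩) h
  have main : ∀ (A B : Set Z) (R : ℝ), (∀ y ∈ A, ∀ z ∈ B, dist y z ≤ R) →
      ∀ y ∈ closure (φ.toFun '' (I ∩ ψ.toFun ⁻¹' A)),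
      ∀ z ∈ closure (φ.toFun '' (I ∩ ψ.toFun ⁻¹' B)), dist y z ≤ R + ε := by
    intro A B R hR y hy z hz
    refine closure_minimal ?_ (isClosed_le (f := fun y => dist y z) (g := fun _ => R + ε)
      (by fun_prop) (by fun_prop)) hy
    rintro _ ⟨s, ⟨hsI, hs⟩, rfl⟩
    refine closure_minimal ?_ (isClosed_le (f := fun z => dist (φ.toFun s) z) (g := fun _ => R + ε)
      (by fun_prop) (by fun_prop)) hz
    rintro _ ⟨t, ⟨htI, ht⟩, rfl⟩
    have h1 := (abs_le.1 (hdist s hsI t htI)).2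
    have h2 := hR _ hs _ ht
    change dist (φ.toFun s) (φ.toFun t) ≤ R + ε
    linarith
  -- The cover is transported through the parameters, where distances change by less than `ε` on
  -- `I`. Closures keep the bounds and make the images measurable.
  refine ⟨fun k => closure (φ.toFun '' (I ∩ ψ.toFun ⁻¹' K k)), fun k => isClosed_closure, ?_, ?_, ?_⟩
  · intro k y hy z hz
    rw [two_mul]
    exact main _ _ _ (hK.dist_le k) y hy z hz
  · intro k l y hy z hz
    exact main _ _ _ (hK.dist_le' k l) y hy z hz
  · have hclosed : MeasurableSet
        (⋃ k ∈ Finset.range N, closure (φ.toFun '' (I ∩ ψ.toFun ⁻¹' K k)))ᶜ :=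
      (Finset.measurableSet_biUnion _ fun k _ => isClosed_closure.measurableSet).compl
    have hZ : MeasurableSet (⋃ k ∈ Finset.range N, K k)ᶜ :=
      (Finset.measurableSet_biUnion _ fun k _ => (hK.isClosed k).measurableSet).compl
    rw [← φ.map_lebesgue, Measure.map_apply φ.measurable_toFun hclosed]
    -- A missed parameter lies outside `I` or is sent by `ψ` outside the old cover; each costs `ε`.
    have hsub : φ.toFun ⁻¹' (⋃ k ∈ Finset.range N, closure (φ.toFun '' (I ∩ ψ.toFun ⁻¹' K k)))ᶜ ⊆
        Iᶜ ∪ ψ.toFun ⁻¹' (⋃ k ∈ Finset.range N, K k)ᶜ := by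
      intro s hs
      by_contra hcon
      simp only [Set.mem_union, Set.mem_compl_iff, Set.mem_preimage, not_or, not_not] at hcon
      obtain ⟨k, hk, hsk⟩ := Set.mem_iUnion₂.1 hcon.2
      exact hs (Set.mem_iUnion₂.2 ⟨k, hk, subset_closure ⟨s, ⟨hcon.1, hsk⟩, rfl⟩⟩)
    have h1 : lebesgue Iᶜ ≤ ENNReal.ofReal ε := by
      rw [← ofReal_measureReal, probReal_compl_eq_one_sub hI]
      exact ENNReal.ofReal_le_ofReal (by linarith)
    have h2 : lebesgue (ψ.toFun ⁻¹' (⋃ k ∈ Finset.range N, K k)ᶜ) ≤ ENNReal.ofReal ε := by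
      rw [← Measure.map_apply ψ.measurable_toFun hZ, ψ.map_lebesgue]
      exact hK.measure_compl
    rw [two_mul, ENNReal.ofReal_add hε.le hε.le]
    exact (measure_mono hsub).trans ((measure_union_le _ _).trans (add_le_add h1 h2))

/-- A box-precompact family has covers whose size is bounded uniformly over the family. -/
lemma BoxPrecompact.exists_isCover {𝒴 : Set MMSpace.{u}} (h : BoxPrecompact 𝒴) {ε : ℝ}
    (hε : 0 < ε) :
    ∃ (N : ℕ) (D : ℝ), ∀ Y ∈ 𝒴, ∃ K : ℕ → Set Y, IsCover Y.measure ε N D K := by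
  -- Half of `ε`, because transport between box-close spaces doubles it.
  obtain ⟨F, hF, hcov⟩ := h (ENNReal.ofReal (ε / 2)) (ENNReal.ofReal_pos.2 (half_pos hε))
  choose N D K hK using fun Z : MMSpace.{u} => MMSpace.exists_isCover Z (half_pos hε)
  obtain ⟨N₀, hN₀⟩ := (hF.image N).bddAbove
  obtain ⟨D₀, hD₀⟩ := (hF.image D).bddAbove
  refine ⟨N₀, D₀ + ε / 2, fun Y hY => ?_⟩
  obtain ⟨Z, hZ, hYZ⟩ := hcov Y hY
  obtain ⟨L, hL⟩ := (hK Z).of_box_lt hYZ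
  refine ⟨L, ?_⟩
  rw [mul_div_cancel₀ ε two_ne_zero] at hL
  exact hL.mono (hN₀ (Set.mem_image_of_mem N hZ))
    (add_le_add_left (hD₀ (Set.mem_image_of_mem D hZ)) _)

/-! ### The scaled ultrametric on sequences -/

/-- The ultrametric on `ℕ → ℕ` in which two sequences that first differ at `n` have distance
`2⁻ⁿ`, scaled by a factor that depends on the first terms. -/
def treeDist (c : ℕ → ℝ) (x y : ℕ → ℕ) : ℝ :=
  max (c (x 0)) (c (y 0)) * @dist _ PiNat.dist x y

lemma piNat_dist_eq_one {x y : ℕ → ℕ} (h : x 0 ≠ y 0) : @dist _ PiNat.dist x y = 1 := by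
  have hne : x ≠ y := fun e => h (congrFun e 0)
  have h0 : PiNat.firstDiff x y = 0 := by
    by_contra h0
    exact h (PiNat.apply_eq_of_lt_firstDiff (Nat.pos_of_ne_zero h0))
  rw [PiNat.dist_eq_of_ne hne, h0, pow_zero]

lemma piNat_dist_le_treeDist {c : ℕ → ℝ} (hc : ∀ i, 1 ≤ c i) (x y : ℕ → ℕ) :
    @dist _ PiNat.dist x y ≤ treeDist c x y :=
  le_mul_of_one_le_left (PiNat.dist_nonneg x y) ((hc _).trans (le_max_left _ _))

/-- If all first terms agree, the scale is constant. Otherwise a leg joining different first terms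
has the full length `max (c i) (c j)`, and such legs dominate the scale at the endpoints. -/
lemma treeDist_triangle {c : ℕ → ℝ} (hc : ∀ i, 1 ≤ c i) (x y z : ℕ → ℕ) :
    treeDist c x z ≤ treeDist c x y + treeDist c y z := by
  have tri := PiNat.dist_triangle x y z
  have nn := PiNat.dist_nonneg (E := fun _ => ℕ)
  have le1 := PiNat.dist_le_one x z
  have c0 : ∀ i j, 0 ≤ max (c i) (c j) := fun i j =>
    zero_le_one.trans ((hc i).trans (le_max_left _ _))
  have hxz : treeDist c x z ≤ max (c (x 0)) (c (z 0)) := mul_le_of_le_one_right (c0 _ _) le1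
  have hxy0 : 0 ≤ treeDist c x y := mul_nonneg (c0 _ _) (nn _ _)
  have hyz0 : 0 ≤ treeDist c y z := mul_nonneg (c0 _ _) (nn _ _)
  by_cases h1 : x 0 = y 0 <;> by_cases h2 : y 0 = z 0
  · simp only [treeDist, h1, h2, max_self]
    rw [← mul_add]
    exact mul_le_mul_of_nonneg_left tri (zero_le_one.trans (hc _))
  · have : treeDist c y z = max (c (y 0)) (c (z 0)) := by
      rw [treeDist, piNat_dist_eq_one h2, mul_one]
    rw [← h1] at this
    linarith
  · have : treeDist c x y = max (c (x 0)) (c (y 0)) := by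
      rw [treeDist, piNat_dist_eq_one h1, mul_one]
    rw [h2] at this
    linarith
  · have e1 : treeDist c x y = max (c (x 0)) (c (y 0)) := by
      rw [treeDist, piNat_dist_eq_one h1, mul_one]
    have e2 : treeDist c y z = max (c (y 0)) (c (z 0)) := by
      rw [treeDist, piNat_dist_eq_one h2, mul_one]
    refine hxz.trans (max_le ?_ ?_)
    · linarith [le_max_left (c (x 0)) (c (y 0))]
    · linarith [le_max_right (c (y 0)) (c (z 0))]

/-- `treeDist c` as a metric compatible with the product topology. -/
abbrev treeMetric (c : ℕ → ℝ) (hc : ∀ i, 1 ≤ c i) : MetricSpace (ℕ → ℕ) :=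
  MetricSpace.ofDistTopology (treeDist c)
    (fun x => by rw [treeDist, PiNat.dist_self, mul_zero])
    (fun x y => by rw [treeDist, treeDist, PiNat.dist_comm, max_comm])
    (treeDist_triangle hc)
    (fun s => by
      rw [PiNat.isOpen_iff_dist]
      refine forall₂_congr fun x _ => ⟨?_, ?_⟩
      · rintro ⟨ε, hε, h⟩
        exact ⟨ε, hε, fun y hy => h y ((piNat_dist_le_treeDist hc x y).trans_lt hy)⟩
      · rintro ⟨ε, hε, h⟩
        have hc0 : 0 < c (x 0) := zero_lt_one.trans_le (hc _)
        -- Distance below 1 forces equal first terms, after which the scale is just `c (x 0)`.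
        refine ⟨min 1 (ε / c (x 0)), by positivity, fun y hy => h y ?_⟩
        have h0 : x 0 = y 0 := by
          by_contra h0
          rw [piNat_dist_eq_one h0] at hy
          exact absurd hy (min_le_left _ _).not_gt
        rw [treeDist, ← h0, max_self, mul_comm]
        exact (lt_div_iff₀ hc0).1 (hy.trans_le (min_le_right _ _)))
    (fun x y h => by
      refine PiNat.eq_of_dist_eq_zero x y (le_antisymm ?_ (PiNat.dist_nonneg x y))
      exact (piNat_dist_le_treeDist hc x y).trans h.le)

lemma completeSpace_treeMetric (c : ℕ → ℝ) (hc : ∀ i, 1 ≤ c i) :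
    @CompleteSpace (ℕ → ℕ) (treeMetric c hc).toUniformSpace := by
  let _ := treeMetric c hc
  refine Metric.complete_of_cauchySeq_tendsto fun v hv => ?_
  rw [Metric.cauchySeq_iff] at hv
  choose M hM using fun n : ℕ => hv ((1 / 2) ^ n) (by positivity)
  refine ⟨fun n => v (M n) n, tendsto_pi_nhds.2 fun n => ?_⟩
  refine tendsto_const_nhds.congr' ?_
  filter_upwards [eventually_ge_atTop (M n)] with k hk
  exact PiNat.apply_eq_of_dist_lt
    ((piNat_dist_le_treeDist hc _ _).trans_lt (hM n _ le_rfl k hk)) le_rfl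

/-- The space of sequences with the metric `treeDist c` and the measure `P`. -/
def treeSpace (c : ℕ → ℝ) (hc : ∀ i, 1 ≤ c i) (P : Measure (ℕ → ℕ)) [IsProbabilityMeasure P] :
    MMSpace.{u} :=
  letI := treeMetric c hc
  haveI := completeSpace_treeMetric c hc
  haveI : BorelSpace (ℕ → ℕ) := Pi.borelSpace
  haveI : TopologicalSpace.SeparableSpace (ULift.{u} (ℕ → ℕ)) :=
    Homeomorph.ulift.symm.surjective.denseRange.separableSpace Homeomorph.ulift.symm.continuous
  haveI : CompleteSpace (ULift.{u} (ℕ → ℕ)) := inferInstance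
  { carrier := ULift.{u} (ℕ → ℕ)
    measure := P.map ULift.up
    prob := Measure.isProbabilityMeasure_map measurable_up.aemeasurable }

lemma dominatedBy_treeSpace {c : ℕ → ℝ} (hc : ∀ i, 1 ≤ c i) (P : Measure (ℕ → ℕ))
    [IsProbabilityMeasure P] {Y : MMSpace.{u}} (f : (ℕ → ℕ) → Y)
    (hf : ∀ x y, dist (f x) (f y) ≤ treeDist c x y) (hf' : Measurable f)
    (hP : P.map f = Y.measure) : Y.DominatedBy (treeSpace c hc P) := by
  refine ⟨fun x => f (ULift.down x), LipschitzWith.of_dist_le_mul fun x y => ?_, ?_⟩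
  · rw [NNReal.coe_one, one_mul]
    exact hf _ _
  · change Measure.map _ (P.map ULift.up) = _
    exact (Measure.map_map (μ := P) (hf'.comp measurable_down) measurable_up).trans hP

/-- The topology of `treeMetric` is the product topology, so a Lipschitz bound gives continuity for
the latter. -/
lemma continuous_of_dist_le_treeDist {c : ℕ → ℝ} (hc : ∀ i, 1 ≤ c i) {Y : Type*} [MetricSpace Y]
    {f : (ℕ → ℕ) → Y} (hf : ∀ x y, dist (f x) (f y) ≤ treeDist c x y) : Continuous f := by
  let _ := treeMetric c hc
  refine (LipschitzWith.of_dist_le_mul (K := 1) fun x y => ?_).continuous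
  rw [NNReal.coe_one, one_mul]
  exact hf x y

/-! ### The mass tree of a single space -/

section

variable {Y : Type*}

/-- The points that are covered at every level from `m` on. -/
def core (N : ℕ → ℕ) (K : ℕ → ℕ → Set Y) (m : ℕ) : Set Y :=
  ⋂ n ≥ m, ⋃ k ∈ Finset.range (N n), K n k

lemma core_subset (N : ℕ → ℕ) (K : ℕ → ℕ → Set Y) {m n : ℕ} (h : m ≤ n) :
    core N K m ⊆ ⋃ k ∈ Finset.range (N n), K n k :=
  Set.biInter_subset_of_mem h

lemma core_mono (N : ℕ → ℕ) (K : ℕ → ℕ → Set Y) : Monotone (core N K) := fun _ _ h =>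
  Set.biInter_subset_biInter_left fun _ hn => le_trans h hn

variable [MetricSpace Y] [MeasurableSpace Y] {μ : Measure Y} {N : ℕ → ℕ} {D : ℕ → ℝ}
  {K : ℕ → ℕ → Set Y}

lemma isClosed_core (hK : ∀ n, IsCover μ ((1 / 2) ^ (n + 1)) (N n) (D n) (K n)) (m : ℕ) :
    IsClosed (core N K m) :=
  isClosed_biInter fun n _ => isClosed_biUnion_finset fun k _ => (hK n).isClosed k

lemma dist_le_of_mem_core (hK : ∀ n, IsCover μ ((1 / 2) ^ (n + 1)) (N n) (D n) (K n)) {m : ℕ}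
    {y z : Y} (hy : y ∈ core N K m) (hz : z ∈ core N K m) : dist y z ≤ D m := by
  obtain ⟨k, -, hk⟩ := Set.mem_iUnion₂.1 (core_subset N K le_rfl hy)
  obtain ⟨l, -, hl⟩ := Set.mem_iUnion₂.1 (core_subset N K le_rfl hz)
  exact (hK m).dist_le' k l y hk z hl

/-- Union bound: the levels from `m` on miss at most `∑ (1/2)^(n+1) = (1/2)^m`. -/
lemma measure_compl_core_le (hK : ∀ n, IsCover μ ((1 / 2) ^ (n + 1)) (N n) (D n) (K n)) (m : ℕ) :
    μ (core N K m)ᶜ ≤ (2 : ℝ≥0∞)⁻¹ ^ m := by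
  have hsub : (core N K m)ᶜ ⊆ ⋃ n, (⋃ k ∈ Finset.range (N (m + n)), K (m + n) k)ᶜ := by
    intro y hy
    simp only [core, Set.mem_compl_iff, Set.mem_iInter, not_forall] at hy
    obtain ⟨n, hn, hy⟩ := hy
    obtain ⟨l, rfl⟩ := Nat.exists_eq_add_of_le hn
    exact Set.mem_iUnion.2 ⟨l, hy⟩
  have hterm : ∀ n : ℕ, ENNReal.ofReal ((1 / 2) ^ (m + n + 1)) =
      (2 : ℝ≥0∞)⁻¹ ^ (m + 1) * (2 : ℝ≥0∞)⁻¹ ^ n := fun n => by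
    rw [ENNReal.ofReal_pow (by norm_num), ← pow_add, one_div, ENNReal.ofReal_inv_of_pos two_pos,
      ENNReal.ofReal_ofNat]
    congr 1
    ring
  calc μ (core N K m)ᶜ ≤ ∑' n, μ (⋃ k ∈ Finset.range (N (m + n)), K (m + n) k)ᶜ :=
        (measure_mono hsub).trans (measure_iUnion_le _)
    _ ≤ ∑' n : ℕ, ENNReal.ofReal ((1 / 2) ^ (m + n + 1)) :=
        ENNReal.tsum_le_tsum fun n => (hK (m + n)).measure_compl
    _ = (2 : ℝ≥0∞)⁻¹ ^ m := by
        simp only [hterm]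
        rw [ENNReal.tsum_mul_left, ENNReal.tsum_geometric, ENNReal.one_sub_inv_two, inv_inv,
          pow_succ, mul_assoc, ENNReal.inv_mul_cancel two_ne_zero ENNReal.ofNat_ne_top, mul_one]

/-- The parameter of the geometric law at level `n` of the tree. -/
def branching (N : ℕ → ℕ) (n : ℕ) : ℕ := if n = 0 then 2 else max (N n) 2

lemma two_le_branching (N : ℕ → ℕ) (n : ℕ) : 2 ≤ branching N n := by
  unfold branching
  split_ifs
  exacts [le_rfl, le_max_right _ _]

/-- The sets that may carry the `j`-th child of a node of level `n` whose first term is `i`. -/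
def allowed (N : ℕ → ℕ) (K : ℕ → ℕ → Set Y) (n i j k : ℕ) : Set Y :=
  if n = 0 then core N K (j + 1) else if i < n then K n k else Set.univ

lemma isClosed_allowed (hK : ∀ n, IsCover μ ((1 / 2) ^ (n + 1)) (N n) (D n) (K n))
    (n i j k : ℕ) : IsClosed (allowed N K n i j k) := by
  unfold allowed
  split_ifs
  exacts [isClosed_core hK _, (hK n).isClosed k, isClosed_univ]

variable [BorelSpace Y]

/-- The children of a node. -/
lemma exists_children [IsProbabilityMeasure μ]
    (hK : ∀ n, IsCover μ ((1 / 2) ^ (n + 1)) (N n) (D n) (K n)) (n i : ℕ) (ν : Measure Y)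
    [IsFiniteMeasure ν] (h0 : n = 0 → ν = μ) (h1 : n ≠ 0 → ν (core N K (i + 1))ᶜ = 0) :
    ∃ (p : ℕ → Measure Y) (k : ℕ → ℕ),
      (∀ j, p j Set.univ = geomWeight (branching N n) j * ν Set.univ) ∧
      (∀ A, ∑' j, p j A = ν A) ∧ ∀ j, p j (allowed N K n i j (k j))ᶜ = 0 := by
  refine exists_geometric_decomposition ν (two_le_branching N n) (allowed N K n i)
    (fun j k => (isClosed_allowed hK n i j k).measurableSet) fun j lam hlam hmass => ?_
  have : IsFiniteMeasure lam := isFiniteMeasure_of_le ν hlam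
  by_cases hn : n = 0
  · subst hn
    obtain rfl := h0 rfl
    refine ⟨0, ?_⟩
    simp only [branching, allowed, if_true, Nat.cast_ofNat, measure_univ, mul_one,
      ENNReal.one_sub_inv_two] at hmass ⊢
    -- The remainder has mass `2⁻¹ ^ j` and the core misses at most half of that, so the other half
    -- can be cut off inside the core.
    have h2 : lam (core N K (j + 1))ᶜ ≤ (2 : ℝ≥0∞)⁻¹ ^ (j + 1) :=
      (hlam _).trans (measure_compl_core_le hK (j + 1))
    have hsplit := measure_add_measure_compl (μ := lam) (isClosed_core hK (j + 1)).measurableSet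
    rw [hmass, ← pow_succ]
    have hhalf : (2 : ℝ≥0∞)⁻¹ ^ j = 2⁻¹ ^ (j + 1) + 2⁻¹ ^ (j + 1) := by
      rw [pow_succ, ← mul_add, ENNReal.inv_two_add_inv_two, mul_one]
    rw [hmass, hhalf] at hsplit
    have hfin : (2 : ℝ≥0∞)⁻¹ ^ (j + 1) ≠ ∞ := ENNReal.pow_ne_top (by simp)
    refine (ENNReal.add_le_add_iff_right hfin).1 ?_
    rw [← hsplit]
    gcongr
  · by_cases hi : i < n
    · simp only [branching, allowed, if_neg hn, if_pos hi]
      -- As `i < n`, the core carrying `ν` is covered by the `N n` sets of level `n`, and the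
      -- pigeonhole applies.
      refine exists_le_measure_of_measure_compl_eq_zero (le_max_left (N n) 2) ?_
      refine le_antisymm ?_ bot_le
      rw [← h1 hn]
      exact (hlam _).trans (measure_mono (Set.compl_subset_compl.2 (core_subset N K hi)))
    -- Level `n` need not cover this core, so the splitting is unconstrained.
    · refine ⟨0, ?_⟩
      simp only [allowed, if_neg hn, if_neg hi]
      refine mul_le_of_le_one_right bot_le ?_
      rw [ENNReal.inv_le_one]
      exact_mod_cast (by have := two_le_branching N n; omega : 1 ≤ branching N n)

/-- A tree of nested closed sets that carry the successive pieces of `μ`. -/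
structure MassTree (μ : Measure Y) (N : ℕ → ℕ) (K : ℕ → ℕ → Set Y) where
  mass : (ℕ → ℕ) → ℕ → Measure Y
  node : (ℕ → ℕ) → ℕ → Set Y
  mass_congr : ∀ x y n, (∀ i < n, x i = y i) → mass x n = mass y n
  node_congr : ∀ x y n, (∀ i < n, x i = y i) → node x n = node y n
  mass_zero : ∀ x, mass x 0 = μ
  mass_univ : ∀ x n, mass x n Set.univ = ∏ k ∈ Finset.range n, geomWeight (branching N k) (x k)
  tsum_mass : ∀ x n A, ∑' j, mass (Function.update x n j) (n + 1) A = mass x n A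
  mass_compl_node : ∀ x n, mass x n (node x n)ᶜ = 0
  isClosed_node : ∀ x n, IsClosed (node x n)
  node_succ_subset : ∀ x n, node x (n + 1) ⊆ node x n
  node_one_subset : ∀ x, node x 1 ⊆ core N K (x 0 + 1)
  node_subset : ∀ x n, x 0 < n → ∃ k, node x (n + 1) ⊆ K n k

lemma exists_massTree [IsProbabilityMeasure μ]
    (hK : ∀ n, IsCover μ ((1 / 2) ^ (n + 1)) (N n) (D n) (K n)) : Nonempty (MassTree μ N K) := by
  have step : ∀ (n i : ℕ) (ν : Measure Y), ∃ (p : ℕ → Measure Y) (k : ℕ → ℕ),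
      IsFiniteMeasure ν → (n = 0 → ν = μ) → (n ≠ 0 → ν (core N K (i + 1))ᶜ = 0) →
      (∀ j, p j Set.univ = geomWeight (branching N n) j * ν Set.univ) ∧
      (∀ A, ∑' j, p j A = ν A) ∧ ∀ j, p j (allowed N K n i j (k j))ᶜ = 0 := by
    intro n i ν
    by_cases h : IsFiniteMeasure ν ∧ (n = 0 → ν = μ) ∧ (n ≠ 0 → ν (core N K (i + 1))ᶜ = 0)
    · obtain ⟨h1, h2, h3⟩ := h
      obtain ⟨p, k, hpk⟩ := exists_children hK n i ν h2 h3
      exact ⟨p, k, fun _ _ _ => hpk⟩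
    · exact ⟨0, 0, fun h1 h2 h3 => absurd ⟨h1, h2, h3⟩ h⟩
  choose p k hpk using step
  -- No first term is available at level 0. The default 0 makes `hd x n` depend only on terms before
  -- `n`.
  let hd : (ℕ → ℕ) → ℕ → ℕ := fun x n => if n = 0 then 0 else x 0
  let mass : (ℕ → ℕ) → ℕ → Measure Y := fun x n =>
    Nat.rec μ (fun n ν => p n (hd x n) ν (x n)) n
  let node : (ℕ → ℕ) → ℕ → Set Y := fun x n =>
    Nat.rec Set.univ (fun n S => S ∩ allowed N K n (hd x n) (x n) (k n (hd x n) (mass x n) (x n))) n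
  have hd_congr : ∀ x y n, (∀ i < n, x i = y i) → hd x n = hd y n := by
    intro x y n h
    simp only [hd]
    split_ifs with hn
    exacts [rfl, h 0 (Nat.pos_of_ne_zero hn)]
  have mass_congr : ∀ x y n, (∀ i < n, x i = y i) → mass x n = mass y n := by
    intro x y n h
    induction n with
    | zero => rfl
    | succ n ih =>
      have h' : ∀ i < n, x i = y i := fun i hi => h i (by omega)
      change p n (hd x n) (mass x n) (x n) = p n (hd y n) (mass y n) (y n)
      rw [hd_congr x y n h', ih h', h n (by omega)]
  have good : ∀ x n, IsFiniteMeasure (mass x n) ∧ (n = 0 → mass x n = μ) ∧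
      (n ≠ 0 → mass x n (core N K (hd x n + 1))ᶜ = 0) := by
    intro x n
    induction n with
    | zero => exact ⟨inferInstanceAs (IsFiniteMeasure μ), fun _ => rfl, fun h => absurd rfl h⟩
    | succ n ih =>
      obtain ⟨h1, h2, h3⟩ := hpk n (hd x n) (mass x n) ih.1 ih.2.1 ih.2.2
      have hle : ∀ A, mass x (n + 1) A ≤ mass x n A := fun A => by
        rw [← h2 A]
        exact ENNReal.le_tsum (f := fun j => p n (hd x n) (mass x n) j A) (x n)
      refine ⟨⟨(hle Set.univ).trans_lt ih.1.measure_univ_lt_top⟩, fun h => absurd h n.succ_ne_zero, fun _ => ?_⟩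
      rcases Nat.eq_zero_or_pos n with rfl | hn
      · exact h3 (x 0)
      · have e : hd x (n + 1) = hd x n := by simp [hd, hn.ne']
        rw [e]
        exact le_antisymm ((hle _).trans (ih.2.2 hn.ne').le) bot_le
  have hpk' := fun x n => hpk n (hd x n) (mass x n) (good x n).1 (good x n).2.1 (good x n).2.2
  refine ⟨⟨mass, node, mass_congr, ?_, fun x => rfl, ?_, ?_, ?_, ?_, fun x n =>
    Set.inter_subset_left, ?_, ?_⟩⟩
  · intro x y n h
    induction n with
    | zero => rfl
    | succ n ih =>
      have h' : ∀ i < n, x i = y i := fun i hi => h i (by omega)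
      change node x n ∩ allowed N K n (hd x n) (x n) (k n (hd x n) (mass x n) (x n)) =
        node y n ∩ allowed N K n (hd y n) (y n) (k n (hd y n) (mass y n) (y n))
      rw [ih h', hd_congr x y n h', mass_congr x y n h', h n (by omega)]
  · intro x n
    induction n with
    | zero => simp [mass]
    | succ n ih =>
      rw [Finset.prod_range_succ, ← ih, mul_comm]
      exact (hpk' x n).1 (x n)
  · intro x n A
    rw [← (hpk' x n).2.1 A]
    refine tsum_congr fun j => ?_
    have h' : ∀ i < n, Function.update x n j i = x i := fun i hi =>
      Function.update_of_ne hi.ne _ _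
    change p n (hd (Function.update x n j) n) (mass (Function.update x n j) n)
      (Function.update x n j n) A = _
    rw [hd_congr _ x n h', mass_congr _ x n h', Function.update_self]
  · intro x n
    induction n with
    | zero => simp [node]
    | succ n ih =>
      change mass x (n + 1) (node x n ∩ _)ᶜ = 0
      rw [Set.compl_inter]
      refine measure_union_null ?_ ((hpk' x n).2.2 (x n))
      refine le_antisymm ?_ bot_le
      rw [← ih, ← (hpk' x n).2.1]
      exact ENNReal.le_tsum (f := fun j => p n (hd x n) (mass x n) j (node x n)ᶜ) (x n)
  · intro x n
    induction n with
    | zero => exact isClosed_univ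
    | succ n ih => exact ih.inter (isClosed_allowed hK _ _ _ _)
  · intro x
    simp [node, allowed]
  · intro x n hn
    refine ⟨k n (hd x n) (mass x n) (x n), ?_⟩
    have hn0 : n ≠ 0 := by omega
    refine Set.inter_subset_right.trans ?_
    simp [allowed, hd, hn0, hn]

end

/-! ### The common measure on sequences -/

/-- Inner regularity extends the inequality to open sets; since both total masses are 1, complements
give the reverse one. -/
lemma measure_eq_of_forall_isClosed_le {Y : Type*} [MetricSpace Y] [MeasurableSpace Y]
    [BorelSpace Y] {μ ρ : Measure Y} [IsProbabilityMeasure μ] [IsProbabilityMeasure ρ]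
    (h : ∀ F, IsClosed F → μ F ≤ ρ F) : μ = ρ := by
  have hopen : ∀ G, IsOpen G → μ G ≤ ρ G := by
    intro G hG
    rw [(Measure.InnerRegularWRT.of_pseudoMetrizableSpace (μ := μ)).measure_eq_iSup hG]
    exact iSup₂_le fun F hFG => iSup_le fun hF => (h F hF).trans (measure_mono hFG)
  refine ext_of_generate_finite {G | IsOpen G} (BorelSpace.measurable_eq (α := Y)) isPiSystem_isOpen
    (fun G hG => le_antisymm (hopen G hG) ?_) (by simp)
  have hc := h Gᶜ (IsOpen.isClosed_compl hG)
  rw [prob_compl_eq_one_sub (IsOpen.measurableSet hG),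
    prob_compl_eq_one_sub (IsOpen.measurableSet hG)] at hc
  exact (ENNReal.sub_le_sub_iff_left prob_le_one ENNReal.one_ne_top).1 hc

/-- The product of the geometric laws that govern the levels of the tree. -/
def treeMeasure (N : ℕ → ℕ) : Measure (ℕ → ℕ) :=
  Measure.infinitePi fun n => geomMeasure (branching N n)

instance (N : ℕ → ℕ) : IsProbabilityMeasure (treeMeasure N) := by
  have := fun n => isProbabilityMeasure_geomMeasure (two_le_branching N n)
  unfold treeMeasure
  infer_instance

lemma treeMeasure_cylinder (N : ℕ → ℕ) (x : ℕ → ℕ) (n : ℕ) :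
    treeMeasure N (PiNat.cylinder x n) =
      ∏ k ∈ Finset.range n, geomWeight (branching N k) (x k) := by
  have := fun n => isProbabilityMeasure_geomMeasure (two_le_branching N n)
  rw [PiNat.cylinder_eq_pi, treeMeasure,
    Measure.infinitePi_pi _ fun i _ => measurableSet_singleton (x i)]
  simp only [geomMeasure_singleton]

/-- Extension of a finite sequence by zeros. -/
def zeroExtend {n : ℕ} (p : Fin n → ℕ) (k : ℕ) : ℕ := if h : k < n then p ⟨k, h⟩ else 0

lemma zeroExtend_snoc {n : ℕ} (p : Fin n → ℕ) (j : ℕ) {i : ℕ} (hi : i < n + 1) :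
    zeroExtend (Fin.snoc p j : Fin (n + 1) → ℕ) i = Function.update (zeroExtend p) n j i := by
  rw [zeroExtend, dif_pos hi]
  rcases Nat.lt_succ_iff_lt_or_eq.1 hi with h | rfl
  · rw [Function.update_of_ne h.ne, zeroExtend, dif_pos h]
    exact Fin.snoc_castSucc (α := fun _ => ℕ) j p ⟨i, h⟩
  · rw [Function.update_self]
    exact Fin.snoc_last (α := fun _ => ℕ) j p

/-! ### The map along the branches of a mass tree -/

namespace MassTree

variable {Y : Type*} [MetricSpace Y] [MeasurableSpace Y] {μ : Measure Y}
  {N : ℕ → ℕ} {D : ℕ → ℝ} {K : ℕ → ℕ → Set Y}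

lemma tsum_mass_zeroExtend (T : MassTree μ N K) (n : ℕ) (A : Set Y) :
    ∑' p : Fin n → ℕ, T.mass (zeroExtend p) n A = μ A := by
  induction n with
  | zero => simp [T.mass_zero]
  | succ n ih =>
    rw [← (Fin.snocEquiv fun _ => ℕ).tsum_eq, ← ih]
    refine (ENNReal.tsum_prod (f := fun (j : ℕ) (p : Fin n → ℕ) =>
      T.mass (zeroExtend (Fin.snoc p j : Fin (n + 1) → ℕ)) (n + 1) A)).trans ?_
    rw [ENNReal.tsum_comm]
    refine tsum_congr fun p => ?_
    rw [← T.tsum_mass]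
    refine tsum_congr fun j => ?_
    rw [T.mass_congr _ _ _ fun i hi => zeroExtend_snoc p j hi]

lemma node_anti (T : MassTree μ N K) (x : ℕ → ℕ) : Antitone (T.node x) :=
  antitone_nat_of_succ_le (T.node_succ_subset x)

/-- A node carries all of a piece of positive mass, as geometric weights never vanish. -/
lemma node_nonempty (T : MassTree μ N K) (x : ℕ → ℕ) (n : ℕ) : (T.node x n).Nonempty := by
  rw [Set.nonempty_iff_ne_empty]
  intro he
  have h := T.mass_compl_node x n
  rw [he, Set.compl_empty, T.mass_univ, Finset.prod_eq_zero_iff] at h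
  obtain ⟨k, -, hk⟩ := h
  exact geomWeight_ne_zero (two_le_branching N k) _ hk

lemma node_subset_core (T : MassTree μ N K) (x : ℕ → ℕ) {n : ℕ} (hn : n ≠ 0) :
    T.node x n ⊆ core N K (x 0 + 1) :=
  (T.node_anti x (Nat.one_le_iff_ne_zero.2 hn)).trans (T.node_one_subset x)

lemma dist_le_of_mem_node (hK : ∀ n, IsCover μ ((1 / 2) ^ (n + 1)) (N n) (D n) (K n))
    (T : MassTree μ N K) {x : ℕ → ℕ} {n : ℕ} (hn : x 0 + 1 < n) {y z : Y}
    (hy : y ∈ T.node x n) (hz : z ∈ T.node x n) : dist y z ≤ (1 / 2) ^ n := by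
  obtain ⟨m, rfl⟩ : ∃ m, n = m + 1 := ⟨n - 1, by omega⟩
  obtain ⟨k, hk⟩ := T.node_subset x m (by omega)
  exact (hK m).dist_le k y (hk hy) z (hk hz)

lemma exists_mem_node [CompleteSpace Y]
    (hK : ∀ n, IsCover μ ((1 / 2) ^ (n + 1)) (N n) (D n) (K n))
    (T : MassTree μ N K) (x : ℕ → ℕ) : ∃ y, ∀ n, y ∈ T.node x n := by
  have hpow : Tendsto (fun n : ℕ => (1 / 2 : ℝ) ^ (n + 1)) atTop (𝓝 0) :=
    (tendsto_pow_atTop_nhds_zero_of_lt_one (by norm_num) (by norm_num)).comp (tendsto_add_atTop_nat 1)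
  -- Cantor's intersection theorem, started at level 1 because level 0 imposes no bound on the
  -- diameter.
  obtain ⟨y, hy⟩ := Metric.nonempty_iInter_of_nonempty_biInter (s := fun n => T.node x (n + 1))
    (fun n => T.isClosed_node x _)
    (fun n => Metric.isBounded_iff.2 ⟨D (x 0 + 1), fun y hy z hz => dist_le_of_mem_core hK
      (T.node_subset_core x n.succ_ne_zero hy) (T.node_subset_core x n.succ_ne_zero hz)⟩)
    (fun M => (T.node_nonempty x (M + 1)).mono
      (Set.subset_iInter₂ fun n hn => T.node_anti x (by omega)))
    (squeeze_zero' (Eventually.of_forall fun n => Metric.diam_nonneg) (by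
      filter_upwards [eventually_gt_atTop (x 0)] with n hn
      exact Metric.diam_le_of_forall_dist_le (by positivity) fun y hy z hz =>
        T.dist_le_of_mem_node hK (by omega) hy hz) hpow)
  exact ⟨y, fun n => T.node_succ_subset x n (Set.mem_iInter.1 hy n)⟩

/-- Branches that split late share a node of diameter at most `(1/2)^n`. For an earlier split the
core bounds the distance by `D (i + 1)`, where `i` is the larger first term; the factor `2 ^ (i +
1)` in `c` compensates for the smallness of the ultrametric up to level `i + 1`. -/
lemma dist_le_treeDist (hK : ∀ n, IsCover μ ((1 / 2) ^ (n + 1)) (N n) (D n) (K n))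
    (T : MassTree μ N K) {c : ℕ → ℝ} (hc : ∀ i, 1 ≤ c i)
    (hcD : ∀ i, D (i + 1) * 2 ^ (i + 1) ≤ c i) {f : (ℕ → ℕ) → Y}
    (hf : ∀ x n, f x ∈ T.node x n) (x y : ℕ → ℕ) : dist (f x) (f y) ≤ treeDist c x y := by
  rcases eq_or_ne x y with rfl | hne
  · rw [dist_self, treeDist, PiNat.dist_self, mul_zero]
  have hcore : ∀ x, f x ∈ core N K (x 0 + 1) := fun x =>
    T.node_subset_core x one_ne_zero (hf x 1)
  by_cases h0 : x 0 = y 0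
  · rw [treeDist, h0, max_self, PiNat.dist_eq_of_ne hne]
    set n := PiNat.firstDiff x y
    have hy : f y ∈ T.node x n := by
      rw [T.node_congr x y n fun i hi => PiNat.apply_eq_of_lt_firstDiff hi]
      exact hf y n
    by_cases hn : x 0 + 1 < n
    · exact (T.dist_le_of_mem_node hK hn (hf x n) hy).trans
        (le_mul_of_one_le_left (by positivity) (hc _))
    · have h1 : dist (f x) (f y) ≤ D (y 0 + 1) :=
        dist_le_of_mem_core hK (h0 ▸ hcore x) (hcore y)
      have h2 : (1 / 2 : ℝ) ^ (y 0 + 1) ≤ (1 / 2) ^ n :=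
        pow_le_pow_of_le_one (by norm_num) (by norm_num) (by omega)
      calc dist (f x) (f y) ≤ D (y 0 + 1) := h1
        _ = D (y 0 + 1) * 2 ^ (y 0 + 1) * (1 / 2) ^ (y 0 + 1) := by
            rw [mul_assoc, ← mul_pow]; norm_num
        _ ≤ c (y 0) * (1 / 2) ^ n :=
            mul_le_mul (hcD _) h2 (by positivity) (zero_le_one.trans (hc _))
  · rw [treeDist, piNat_dist_eq_one h0, mul_one]
    have key : ∀ i, f x ∈ core N K (i + 1) → f y ∈ core N K (i + 1) → dist (f x) (f y) ≤ c i := by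
      intro i hx hy
      have h1 := dist_le_of_mem_core hK hx hy
      refine h1.trans (le_trans ?_ (hcD i))
      exact le_mul_of_one_le_right (dist_nonneg.trans h1) (one_le_pow₀ one_le_two)
    rcases le_total (x 0) (y 0) with h | h
    · exact (key (y 0) (core_mono N K (by omega) (hcore x)) (hcore y)).trans (le_max_right _ _)
    · exact (key (x 0) (hcore x) (core_mono N K (by omega) (hcore y))).trans (le_max_left _ _)

lemma isOpen_setOf_node_inter_nonempty (T : MassTree μ N K) (F : Set Y) (n : ℕ) :
    IsOpen {x | (T.node x n ∩ F).Nonempty} := by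
  refine isOpen_iff_forall_mem_open.2 fun x hx => ⟨PiNat.cylinder x n, fun y hy => ?_,
    PiNat.isOpen_cylinder _ x n, PiNat.self_mem_cylinder x n⟩
  rw [Set.mem_ofPred_eq, T.node_congr y x n hy]
  exact hx

/-- A piece can charge `F` only if its node meets `F`, and its total mass is that of its cylinder.
-/
lemma measure_le_treeMeasure (T : MassTree μ N K) (F : Set Y) (n : ℕ) :
    μ F ≤ treeMeasure N {x | (T.node x n ∩ F).Nonempty} := by
  set U : Set (ℕ → ℕ) := {x | (T.node x n ∩ F).Nonempty} with hU
  have hterm : ∀ p : Fin n → ℕ, T.mass (zeroExtend p) n F ≤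
      treeMeasure N (PiNat.cylinder (zeroExtend p) n ∩ U) := by
    intro p
    by_cases hp : zeroExtend p ∈ U
    · have hsub : PiNat.cylinder (zeroExtend p) n ⊆ U := fun y hy => by
        rw [hU, Set.mem_ofPred_eq, T.node_congr y _ n hy]
        exact hp
      rw [Set.inter_eq_left.2 hsub, treeMeasure_cylinder, ← T.mass_univ]
      exact measure_mono (Set.subset_univ F)
    · have hsub : F ⊆ (T.node (zeroExtend p) n)ᶜ := fun y hy hy' => hp ⟨y, hy', hy⟩
      exact (measure_mono hsub).trans ((T.mass_compl_node _ n).le.trans bot_le)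
  have hdisj : Pairwise (Function.onFun Disjoint
      fun p : Fin n → ℕ => PiNat.cylinder (zeroExtend p) n ∩ U) := by
    intro p q hpq
    refine Set.disjoint_left.2 fun x hx hx' => hpq (funext fun i => ?_)
    have := (hx.1 i i.2).symm.trans (hx'.1 i i.2)
    simpa [zeroExtend] using this
  calc μ F = ∑' p : Fin n → ℕ, T.mass (zeroExtend p) n F := (T.tsum_mass_zeroExtend n F).symm
    _ ≤ ∑' p : Fin n → ℕ, treeMeasure N (PiNat.cylinder (zeroExtend p) n ∩ U) :=
        ENNReal.tsum_le_tsum hterm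
    _ = treeMeasure N (⋃ p : Fin n → ℕ, PiNat.cylinder (zeroExtend p) n ∩ U) :=
        (measure_iUnion hdisj fun p => ((PiNat.isOpen_cylinder _ _ n).inter
          (T.isOpen_setOf_node_inter_nonempty F n)).measurableSet).symm
    _ ≤ treeMeasure N U := measure_mono (Set.iUnion_subset fun p => Set.inter_subset_right)

/-- Let `n` tend to infinity in `measure_le_treeMeasure`: if all nodes of `x` meet a closed `F`,
then, since they shrink to `f x`, that point lies in `F`. The inequality on closed sets suffices for
equality. -/
lemma map_treeMeasure [BorelSpace Y] [IsProbabilityMeasure μ]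
    (hK : ∀ n, IsCover μ ((1 / 2) ^ (n + 1)) (N n) (D n) (K n))
    (T : MassTree μ N K) {f : (ℕ → ℕ) → Y} (hf : ∀ x n, f x ∈ T.node x n) (hf' : Measurable f) :
    (treeMeasure N).map f = μ := by
  have := Measure.isProbabilityMeasure_map (μ := treeMeasure N) hf'.aemeasurable
  refine (measure_eq_of_forall_isClosed_le fun F hF => ?_).symm
  rw [Measure.map_apply hf' hF.measurableSet]
  have hlim := tendsto_measure_iInter_atTop (μ := treeMeasure N)
    (fun n => (T.isOpen_setOf_node_inter_nonempty F n).measurableSet.nullMeasurableSet)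
    (fun m n h x hx => hx.mono (Set.inter_subset_inter_left F (T.node_anti x h)))
    ⟨0, measure_ne_top _ _⟩
  refine (ge_of_tendsto' hlim fun n => T.measure_le_treeMeasure F n).trans (measure_mono ?_)
  intro x hx
  refine hF.closure_subset (Metric.mem_closure_iff.2 fun ε hε => ?_)
  have hpow : Tendsto (fun n : ℕ => (1 / 2 : ℝ) ^ n) atTop (𝓝 0) :=
    tendsto_pow_atTop_nhds_zero_of_lt_one (by norm_num) (by norm_num)
  obtain ⟨n, hn, hn'⟩ := ((hpow.eventually (gt_mem_nhds hε)).and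
    (eventually_gt_atTop (x 0 + 1))).exists
  obtain ⟨z, hz, hzF⟩ := Set.mem_iInter.1 hx n
  exact ⟨z, hzF, (T.dist_le_of_mem_node hK hn' (hf x n) hz).trans_lt hn⟩

end MassTree

end MMSpace

end

theorem theorem1p1 (𝒴 : Set MMSpace.{u}) (h𝒴 : MMSpace.BoxPrecompact 𝒴) :
    ∃ X : MMSpace.{u}, ∀ Y ∈ 𝒴, MMSpace.DominatedBy Y X := by
  choose N D hND using fun n : ℕ => h𝒴.exists_isCover (ε := (1 / 2) ^ (n + 1)) (by positivity)
  let c : ℕ → ℝ := fun i => max 1 (D (i + 1) * 2 ^ (i + 1))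
  have hc : ∀ i, 1 ≤ c i := fun i => le_max_left _ _
  -- Only the uniform data `N` and `D` enter; the covers `K` and the tree are chosen after `Y`.
  refine ⟨MMSpace.treeSpace c hc (MMSpace.treeMeasure N), fun Y hY => ?_⟩
  choose K hK using fun n => hND n Y hY
  obtain ⟨T⟩ := MMSpace.exists_massTree hK
  choose f hf using T.exists_mem_node hK
  have hdist := T.dist_le_treeDist hK hc (fun i => le_max_right _ _) hf
  have hmeas : Measurable f := (MMSpace.continuous_of_dist_le_treeDist hc hdist).measurable
  exact MMSpace.dominatedBy_treeSpace hc _ f hdist hmeas (T.map_treeMeasure hK hf hmeas)
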